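/- All rings are associative with identity, not necessarily commutative, and ring homomorphisms preserve the identity. A group $G$ is called *fully realizable* if there is a ring $R$ and an isomorphism of groups $R^\times \cong G$ such that, identifying $R^\times$ with $G$ along it, every group endomorphism of $G$ is the restriction to units of some ring endomorphism of $R$. A group is *simple* if it is nontrivial and its only normal subgroups are the trivial subgroup and the whole group. Let $\mathbf{A}_n$ denote the alternating group on $n$ letters. **Theorem.** The groups $\mathbf{A}_2$ and $\mathbf{A}_3$ are fully realizable, and for every integer $n \ge 4$ the following are equivalent: 1. $n = 4$; 2. $\mathbf{A}_n$ is fully realizable; 3. $\mathbf{A}_n$ is not simple. -/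

import Mathlib

universe u v

/-- The ring `R` (with identity, not necessarily commutative) fully realizes the group `G`:
there is an isomorphism `e` from the unit group of `R` to `G` under which every group endomorphism
of `G` is the map `Units.map φ` induced on units by some (unital) ring endomorphism `φ` of `R`. -/
def FullyRealizes (R : Type v) [Ring R] (G : Type u) [Group G] : Prop :=
  ∃ e : Rˣ ≃* G, ∀ f : G →* G, ∃ φ : R →+* R,
    ∀ x : Rˣ, e (Units.map (φ : R →* R) x) = f (e x)

/-- The group `G` is fully realizable: some ring (in the universe `v`) fully realizes it. -/
def FullyRealizable (G : Type u) [Group G] : Prop :=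
  ∃ (R : Type v) (_ : Ring R), FullyRealizes R G

/-!
The trivial endomorphism of `G` comes from a ring endomorphism, which fixes `-1`; hence `-1 = 1` and
`R` has characteristic two. Replacing `R` by the subring generated by its units makes it finite. If
`G = Rˣ` is moreover simple with trivial centre, then the kernel `1 + J` of reduction modulo the
Jacobson radical `J` is a normal `2`-subgroup, so `J = 0`. By Wedderburn, `R` is a product of matrix
rings; one factor carries the whole unit group, is a matrix ring over `𝔽₂`, and the other factors
are commutative. By Skolem–Noether every automorphism of `G` is then inner, whereas for `n ≥ 5`
conjugation by a transposition is an outer automorphism of `Aₙ`.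

Conversely, `A₃` is the unit group of `𝔽₄ × 𝔽₂`, and `A₄` is the group of affine permutations of the
line over `𝔽₄`, that is, the unit group of the triangular matrices `!![a, b; 0, c]` with `a, b` in
`𝔽₄` and `c` in `𝔽₂`.
-/

section SimpleGroups

theorem center_eq_bot_of_mulEquiv {G H : Type*} [Group G] [Group H] (e : G ≃* H)
    (hG : Subgroup.center G = ⊥) : Subgroup.center H = ⊥ := by
  rw [Subgroup.eq_bot_iff_card] at hG ⊢
  rw [← hG, Nat.card_congr (Subgroup.centerCongr e).toEquiv]

theorem eq_bot_of_isPGroup_of_isSimpleGroup {G : Type*} [Group G] [Finite G] [IsSimpleGroup G]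
    (hG : Subgroup.center G = ⊥) {p : ℕ} [Fact p.Prime] {N : Subgroup G} [hN : N.Normal]
    (hp : IsPGroup p N) : N = ⊥ := by
  refine hN.eq_bot_or_eq_top.resolve_right ?_
  rintro rfl
  have := (hp.of_equiv Subgroup.topEquiv).center_nontrivial
  exact (Subgroup.nontrivial_iff_ne_bot _).1 this hG

theorem exists_bijective_evalMonoidHom_of_isSimpleGroup {ι : Type*} {G : ι → Type*}
    [∀ i, Group (G i)] [IsSimpleGroup (∀ i, G i)] :
    ∃ i, Function.Bijective (Pi.evalMonoidHom G i) ∧ ∀ j ≠ i, Subsingleton (G j) := by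
  classical
  obtain ⟨i, hi⟩ : ∃ i, Nontrivial (G i) := by
    by_contra! h
    exact not_subsingleton (∀ i, G i) inferInstance
  have hsurj : Function.Surjective (Pi.evalMonoidHom G i) := Function.surjective_eval i
  have hinj : Function.Injective (Pi.evalMonoidHom G i) := by
    rw [← MonoidHom.ker_eq_bot_iff]
    refine (Pi.evalMonoidHom G i).normal_ker.eq_bot_or_eq_top.resolve_right fun htop ↦ ?_
    obtain ⟨y, hy⟩ := exists_ne (1 : G i)
    obtain ⟨x, rfl⟩ := hsurj y
    exact hy (MonoidHom.mem_ker.1 (htop ▸ Subgroup.mem_top x))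
  refine ⟨i, ⟨hinj, hsurj⟩, fun j hj ↦ ⟨fun x y ↦ Pi.mulSingle_injective j (hinj ?_)⟩⟩
  simp [Pi.mulSingle_eq_of_ne hj.symm]

end SimpleGroups

section UnitSubring

/-- The subring generated by the units of a ring. Passing to it does not change the unit group, and
it is finite as soon as the characteristic is positive and there are finitely many units. -/
def unitSubring (R : Type*) [Ring R] : Subring R := Subring.closure {x | IsUnit x}

variable {R S : Type*} [Ring R] [Ring S]

theorem val_mem_unitSubring (u : Rˣ) : (u : R) ∈ unitSubring R :=
  Subring.subset_closure u.isUnit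

theorem unitSubring_le {T : Subring R} (h : ∀ u : Rˣ, (u : R) ∈ T) : unitSubring R ≤ T := by
  rw [unitSubring, Subring.closure_le]
  rintro _ ⟨u, rfl⟩
  exact h u

theorem map_mem_unitSubring (f : R →+* S) {x : R} (hx : x ∈ unitSubring R) :
    f x ∈ unitSubring S :=
  unitSubring_le (T := (unitSubring S).comap f)
    (fun u ↦ val_mem_unitSubring (Units.map (f : R →* S) u)) hx

theorem unitSubring_eq_top_of_surjective {f : R →+* S} (hf : Function.Surjective f)
    (hR : unitSubring R = ⊤) : unitSubring S = ⊤ := by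
  refine (Subring.eq_top_iff' _).2 fun y ↦ ?_
  obtain ⟨x, rfl⟩ := hf y
  exact map_mem_unitSubring f (hR ▸ Subring.mem_top x)

theorem surjective_of_surjective_unitsMap (hS : unitSubring S = ⊤) {f : R →+* S}
    (hf : Function.Surjective (Units.map (f : R →* S))) : Function.Surjective f := by
  rw [← RingHom.range_eq_top, eq_top_iff, ← hS]
  refine unitSubring_le fun u ↦ ?_
  obtain ⟨v, rfl⟩ := hf u
  exact ⟨v, rfl⟩

theorem commute_of_subsingleton_units [Subsingleton Rˣ] (hR : unitSubring R = ⊤) (x y : R) :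
    Commute x y := by
  have hle : unitSubring R ≤ Subring.center R := unitSubring_le fun u ↦ by
    simp [Subsingleton.elim u 1]
  exact (Subring.mem_center_iff.1 (hle (hR ▸ Subring.mem_top y)) x)

/-- The units of the subring generated by the units are all the units. -/
def unitSubringUnitsEquiv (R : Type*) [Ring R] : (unitSubring R)ˣ ≃* Rˣ where
  toFun := Units.map ((unitSubring R).subtype : unitSubring R →* R)
  invFun u := ⟨⟨u, val_mem_unitSubring u⟩, ⟨(u⁻¹ : Rˣ), val_mem_unitSubring u⁻¹⟩,
    Subtype.ext u.mul_inv, Subtype.ext u.inv_mul⟩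
  left_inv _ := rfl
  right_inv _ := rfl
  map_mul' := map_mul _

theorem unitSubring_unitSubring (R : Type*) [Ring R] : unitSubring (unitSubring R) = ⊤ := by
  have hle : unitSubring R ≤ (unitSubring (unitSubring R)).map (unitSubring R).subtype :=
    unitSubring_le fun u ↦ ⟨_, val_mem_unitSubring ((unitSubringUnitsEquiv R).symm u), rfl⟩
  refine (Subring.eq_top_iff' _).2 fun x ↦ ?_
  obtain ⟨y, hy, hyx⟩ := hle x.2
  rwa [← Subtype.ext hyx]

theorem finite_unitSubring (n : ℕ) [NeZero n] [CharP R n] [Finite Rˣ] : Finite (unitSubring R) := by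
  let _ : Algebra (ZMod n) R := ZMod.algebra R n
  let F : MonoidAlgebra (ZMod n) Rˣ →ₐ[ZMod n] R := MonoidAlgebra.lift _ _ _ (Units.coeHom R)
  have : Finite (MonoidAlgebra (ZMod n) Rˣ) := Module.finite_of_finite (ZMod n)
  have : Finite F.toRingHom.range := Finite.of_surjective _ F.toRingHom.rangeRestrict_surjective
  have hle : unitSubring R ≤ F.toRingHom.range :=
    unitSubring_le fun u ↦ ⟨MonoidAlgebra.of _ _ u, by simp [F]⟩
  exact Finite.of_injective _ (Subring.inclusion_injective hle)

end UnitSubring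

section NilKernel

variable {R S : Type*} [Ring R] [Ring S] {f : R →+* S}

theorem eq_zero_of_injective_unitsMap (hf : ∀ x, f x = 0 → IsNilpotent x)
    (hinj : Function.Injective (Units.map (f : R →* S))) {x : R} (hx : f x = 0) : x = 0 := by
  obtain ⟨u, hu⟩ := (hf x hx).isUnit_one_add
  have h1 : u = 1 := hinj (Units.ext (by simp [hu, hx]))
  simpa [h1] using hu

theorem isPGroup_ker_unitsMap (p : ℕ) [Fact p.Prime] [CharP R p]
    (hf : ∀ x, f x = 0 → IsNilpotent x) : IsPGroup p (Units.map (f : R →* S)).ker := by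
  rintro ⟨u, hu⟩
  have hfu : f u = 1 := by simpa using congr_arg Units.val (MonoidHom.mem_ker.1 hu)
  obtain ⟨n, hn⟩ := hf (u - 1) (by simp [hfu])
  have hpow : (u : R) ^ p ^ n - 1 = 0 := by
    rw [← one_pow (p ^ n), ← sub_pow_char_pow_of_commute p n (Commute.one_right (u : R))]
    exact pow_eq_zero_of_le (Nat.lt_pow_self (Fact.out : p.Prime).one_lt).le hn
  exact ⟨n, Subtype.ext (Units.ext (by simpa using sub_eq_zero.1 hpow))⟩

theorem isSemisimpleRing_of_isSimpleGroup_units [IsArtinianRing R] [Finite Rˣ]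
    [IsSimpleGroup Rˣ] (hR : Subgroup.center Rˣ = ⊥) (p : ℕ) [Fact p.Prime] [CharP R p] :
    IsSemisimpleRing R := by
  rw [IsArtinianRing.isSemisimpleRing_iff_jacobson, eq_bot_iff]
  have hnil (x : R) (hx : Ideal.Quotient.mk (Ring.jacobson R) x = 0) : IsNilpotent x := by
    obtain ⟨n, hn⟩ := IsSemiprimaryRing.isNilpotent (R := R)
    exact ⟨n, by simpa [hn] using Ideal.pow_mem_pow (Ideal.Quotient.eq_zero_iff_mem.1 hx) n⟩
  have hker := eq_bot_of_isPGroup_of_isSimpleGroup hR (isPGroup_ker_unitsMap p hnil)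
  exact fun x hx ↦ eq_zero_of_injective_unitsMap hnil ((MonoidHom.ker_eq_bot_iff _).1 hker)
    (Ideal.Quotient.eq_zero_iff_mem.2 hx)

end NilKernel

section CommutatorAnnihilator

/-- The left annihilator of the additive commutators of a ring. In a product of noncommutative
matrix rings and commutative rings it is the product of the commutative factors, which
characterizes the latter independently of the decomposition. -/
def commutatorAnnihilator (R : Type*) [Ring R] : Set R := {x | ∀ a b : R, x * ⁅a, b⁆ = 0}

theorem map_mem_commutatorAnnihilator {R S : Type*} [Ring R] [Ring S] {f : R →+* S}
    (hf : Function.Surjective f) {x : R} (hx : x ∈ commutatorAnnihilator R) :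
    f x ∈ commutatorAnnihilator S := by
  intro a b
  obtain ⟨a, rfl⟩ := hf a
  obtain ⟨b, rfl⟩ := hf b
  have h := congr_arg f (hx a b)
  simpa only [Ring.lie_def, map_mul, map_sub, map_zero] using h

theorem eq_zero_of_mem_commutatorAnnihilator_matrix {R n : Type*} [Ring R] [Fintype n]
    [DecidableEq n] [Nontrivial n] {T : Matrix n n R}
    (hT : T ∈ commutatorAnnihilator (Matrix n n R)) : T = 0 := by
  ext k i
  obtain ⟨j, hj⟩ := exists_ne i
  have h := congr_fun₂ (hT (Matrix.single i i 1) (Matrix.single i j 1)) k j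
  simpa [Ring.lie_def, hj, Matrix.single_mul_single_of_ne] using h

theorem mem_commutatorAnnihilator_pi {ι : Type*} {R : ι → Type*} [∀ i, Ring (R i)] {i : ι}
    (hcomm : ∀ j ≠ i, ∀ a b : R j, Commute a b) {x : ∀ j, R j} (hx : x i = 0) :
    x ∈ commutatorAnnihilator (∀ j, R j) := by
  intro a b
  ext j
  by_cases hj : j = i
  · subst hj
    rw [Pi.mul_apply, hx, zero_mul, Pi.zero_apply]
  · rw [Pi.mul_apply, Ring.lie_def, Pi.sub_apply, Pi.mul_apply, Pi.mul_apply,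
      (hcomm j hj (a j) (b j)).eq, sub_self, mul_zero, Pi.zero_apply]

end CommutatorAnnihilator

section MatrixRings

variable {n : Type*} [Fintype n] [DecidableEq n]

theorem subsingleton_units_of_center_units_matrix_eq_bot {R : Type*} [CommRing R] [Nonempty n]
    (h : Subgroup.center (Matrix n n R)ˣ = ⊥) : Subsingleton Rˣ := by
  have hrange : (Matrix.GeneralLinearGroup.scalar n : Rˣ →* _).range = ⊥ :=
    (Matrix.GeneralLinearGroup.center_eq_range_scalar (n := n)).symm.trans h
  refine subsingleton_of_forall_eq 1 fun a ↦ Units.ext ?_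
  have ha : Matrix.GeneralLinearGroup.scalar n a = 1 := Subgroup.mem_bot.1 (hrange ▸ ⟨a, rfl⟩)
  have ha' : Matrix.scalar n (a : R) = 1 := congr_arg Units.val ha
  exact Matrix.scalar_inj.1 (ha'.trans (map_one _).symm)

theorem nontrivial_of_center_units_matrix_eq_bot {R : Type*} [CommRing R]
    [Nontrivial (Matrix n n R)ˣ] (h : Subgroup.center (Matrix n n R)ˣ = ⊥) : Nontrivial n := by
  rw [← not_subsingleton_iff_nontrivial]
  intro _
  obtain ⟨A, hA⟩ := exists_ne (1 : (Matrix n n R)ˣ)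
  refine hA (Subgroup.mem_bot.1 (h ▸ Subgroup.mem_center_iff.2 fun B ↦ ?_))
  ext i j
  obtain rfl := Subsingleton.elim i j
  simp [Matrix.mul_apply, Fintype.sum_subsingleton _ i, mul_comm]

theorem nonempty_ringEquiv_zmod_two_of_center_units_matrix_eq_bot {D : Type*} [DivisionRing D]
    [Finite D] [Nonempty n] (h : Subgroup.center (Matrix n n D)ˣ = ⊥) :
    Nonempty (D ≃+* ZMod 2) := by
  let _ : Field D := littleWedderburn D
  have := subsingleton_units_of_center_units_matrix_eq_bot h
  have := Fintype.ofFinite D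
  have hcard : Fintype.card D = 2 := by
    rw [← Nat.card_eq_fintype_card, Nat.card_eq_card_units_add_one, Nat.card_unique]
  exact ⟨(ZMod.ringEquivOfPrime D Nat.prime_two hcard).symm⟩

theorem exists_units_conj_of_matrix_algEquiv {K : Type*} [Field K]
    (ψ : Matrix n n K ≃ₐ[K] Matrix n n K) :
    ∃ P : (Matrix n n K)ˣ, ∀ A, ψ A = P * A * (P⁻¹ : (Matrix n n K)ˣ) := by
  let θ : Matrix n n K ≃ₐ[K] Module.End K (n → K) := Matrix.toLinAlgEquiv'
  obtain ⟨T, hT⟩ := ((θ.symm.trans ψ).trans θ).eq_linearEquivConjAlgEquiv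
  refine ⟨Units.map (θ.symm : Module.End K (n → K) →* Matrix n n K)
    (LinearMap.GeneralLinearGroup.ofLinearEquiv T), fun A ↦ θ.injective ?_⟩
  have hconj : θ (ψ A) = T.conjAlgEquiv K (θ A) := by
    simpa only [AlgEquiv.trans_apply, AlgEquiv.symm_apply_apply] using congr($hT (θ A))
  rw [hconj, ← map_inv]
  simp only [map_mul, Units.coe_map, MonoidHom.coe_coe, AlgEquiv.apply_symm_apply]
  rfl

theorem exists_units_conj_of_surjective_matrix_zmod {p : ℕ} [Fact p.Prime]
    {ψ : Matrix n n (ZMod p) →+* Matrix n n (ZMod p)} (hψ : Function.Surjective ψ) :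
    ∃ P : (Matrix n n (ZMod p))ˣ, ∀ A, ψ A = P * A * (P⁻¹ : (Matrix n n (ZMod p))ˣ) :=
  exists_units_conj_of_matrix_algEquiv <|
    AlgEquiv.ofRingEquiv
      (f := RingEquiv.ofBijective ψ ⟨Finite.injective_iff_surjective.2 hψ, hψ⟩) fun r ↦
        congr($(RingHom.ext_zmod (ψ.comp (algebraMap (ZMod p) _)) (algebraMap (ZMod p) _)) r)

end MatrixRings

section InnerAutomorphisms

theorem exists_bijective_unitsMap_of_ringEquiv_pi {S ι : Type*} [Ring S] [IsSimpleGroup Sˣ]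
    {R : ι → Type*} [∀ i, Ring (R i)] (e : S ≃+* ∀ i, R i) :
    ∃ i, Function.Bijective
        (Units.map ((Pi.evalRingHom R i).comp (e : S →+* ∀ i, R i) : S →* R i)) ∧
      ∀ j ≠ i, Subsingleton (R j)ˣ := by
  let E : Sˣ ≃* ∀ i, (R i)ˣ := (Units.mapEquiv e.toMulEquiv).trans MulEquiv.piUnits
  have : IsSimpleGroup (∀ i, (R i)ˣ) := E.symm.isSimpleGroup
  obtain ⟨i, hi, hj⟩ := exists_bijective_evalMonoidHom_of_isSimpleGroup (G := fun i ↦ (R i)ˣ)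
  exact ⟨i, hi.comp E.bijective, hj⟩

theorem mem_commutatorAnnihilator_of_ringEquiv_pi {S ι : Type*} [Ring S]
    (hS : unitSubring S = ⊤) {R : ι → Type*} [∀ i, Ring (R i)] (e : S ≃+* ∀ i, R i) {i : ι}
    (hi : ∀ j ≠ i, Subsingleton (R j)ˣ) {x : S} (hx : e x i = 0) :
    x ∈ commutatorAnnihilator S := by
  have hcomm (j : ι) (hj : j ≠ i) (a b : R j) : Commute a b :=
    have := hi j hj
    have hsurj : Function.Surjective ((Pi.evalRingHom R j).comp (e : S →+* ∀ i, R i)) :=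
      (Function.surjective_eval j).comp e.surjective
    commute_of_subsingleton_units (unitSubring_eq_top_of_surjective hsurj hS) a b
  simpa using map_mem_commutatorAnnihilator (f := (e.symm : (∀ i, R i) →+* S)) e.symm.surjective
    (mem_commutatorAnnihilator_pi hcomm hx)

variable {S : Type*} [Ring S] [Finite S] [IsSemisimpleRing S] [IsSimpleGroup Sˣ]

theorem exists_surjective_matrix_zmod_two (hc : Subgroup.center Sˣ = ⊥)
    (hS : unitSubring S = ⊤) :
    ∃ (m : ℕ) (π : S →+* Matrix (Fin m) (Fin m) (ZMod 2)), Nontrivial (Fin m) ∧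
      Function.Surjective π ∧
      Function.Bijective (Units.map (π : S →* Matrix (Fin m) (Fin m) (ZMod 2))) ∧
      ∀ x, π x = 0 → x ∈ commutatorAnnihilator S := by
  obtain ⟨n, D, d, _, hd, ⟨e⟩⟩ := IsSemisimpleRing.exists_ringEquiv_pi_matrix_divisionRing S
  obtain ⟨i, hbij, hi⟩ := exists_bijective_unitsMap_of_ringEquiv_pi e
  have := hd i
  have hsurj : Function.Surjective fun x ↦ e x i := (Function.surjective_eval i).comp e.surjective
  have : Finite (Matrix (Fin (d i)) (Fin (d i)) (D i)) := .of_surjective _ hsurj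
  have : Finite (D i) := .of_injective (Matrix.scalar (Fin (d i))) fun a b h ↦ by simpa using h
  have hcenter := center_eq_bot_of_mulEquiv (MulEquiv.ofBijective _ hbij) hc
  obtain ⟨ε⟩ := nonempty_ringEquiv_zmod_two_of_center_units_matrix_eq_bot hcenter
  let π : S →+* Matrix (Fin (d i)) (Fin (d i)) (D i) :=
    (Pi.evalRingHom (fun i ↦ Matrix (Fin (d i)) (Fin (d i)) (D i)) i).comp (e : S →+* _)
  let δ : Matrix (Fin (d i)) (Fin (d i)) (D i) ≃+* Matrix (Fin (d i)) (Fin (d i)) (ZMod 2) :=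
    ε.mapMatrix
  have hδ := (Units.mapEquiv δ.toMulEquiv).bijective.comp hbij
  have hcenter' := center_eq_bot_of_mulEquiv (Units.mapEquiv δ.toMulEquiv) hcenter
  have : Nontrivial (Matrix (Fin (d i)) (Fin (d i)) (ZMod 2))ˣ :=
    (Equiv.ofBijective _ hδ).nontrivial_congr.1 inferInstance
  refine ⟨d i, δ.toRingHom.comp π, nontrivial_of_center_units_matrix_eq_bot hcenter',
    δ.surjective.comp hsurj, hδ, fun x hx ↦ ?_⟩
  exact mem_commutatorAnnihilator_of_ringEquiv_pi hS e hi ((map_eq_zero_iff δ δ.injective).1 hx)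

theorem exists_units_conj_of_surjective_unitsMap (hc : Subgroup.center Sˣ = ⊥)
    (hS : unitSubring S = ⊤) {φ : S →+* S} (hφ : Function.Surjective (Units.map (φ : S →* S))) :
    ∃ y : Sˣ, ∀ u : Sˣ, Units.map (φ : S →* S) u = y * u * y⁻¹ := by
  obtain ⟨m, π, _, hπ, ⟨hinj, hsurj⟩, hker⟩ := exists_surjective_matrix_zmod_two hc hS
  have hπφ : Function.Surjective (π.comp φ) := hπ.comp (surjective_of_surjective_unitsMap hS hφ)
  have hle : RingHom.ker π ≤ RingHom.ker (π.comp φ) := fun x hx ↦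
    eq_zero_of_mem_commutatorAnnihilator_matrix (map_mem_commutatorAnnihilator hπφ (hker x hx))
  let ψ := π.liftOfSurjective hπ ⟨π.comp φ, hle⟩
  have hψ (x : S) : ψ (π x) = π (φ x) := π.liftOfRightInverse_comp_apply _ _ ⟨π.comp φ, hle⟩ x
  have hψsurj : Function.Surjective ψ := .of_comp (g := π) <| by
    rwa [show ψ ∘ π = π.comp φ from funext hψ]
  obtain ⟨P, hP⟩ := exists_units_conj_of_surjective_matrix_zmod hψsurj
  obtain ⟨y, rfl⟩ := hsurj P
  refine ⟨y, fun u ↦ hinj (Units.ext ?_)⟩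
  simpa [← hψ, ← map_inv] using hP (π u)

end InnerAutomorphisms

namespace FullyRealizes

variable {R : Type*} [Ring R] {G : Type*} [Group G]

theorem charP_two [Nontrivial R] (h : FullyRealizes R G) : CharP R 2 := by
  obtain ⟨e, he⟩ := h
  obtain ⟨φ, hφ⟩ := he 1
  have hneg : (-1 : Rˣ) = 1 := by
    simpa [Units.ext_iff] using e.injective ((hφ (-1)).trans (map_one e).symm)
  have hneg' : (-1 : R) = 1 := congr_arg Units.val hneg
  refine CharTwo.of_one_ne_zero_of_two_eq_zero one_ne_zero ?_
  rw [← one_add_one_eq_two]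
  exact (eq_neg_iff_add_eq_zero).1 hneg'.symm

theorem unitSubring (h : FullyRealizes R G) : FullyRealizes (unitSubring R) G := by
  obtain ⟨e, he⟩ := h
  refine ⟨(unitSubringUnitsEquiv R).trans e, fun f ↦ ?_⟩
  obtain ⟨φ, hφ⟩ := he f
  exact ⟨φ.restrict _ _ fun _ ↦ map_mem_unitSubring φ, fun x ↦ hφ (unitSubringUnitsEquiv R x)⟩

theorem mulAut_conj_surjective [Finite G] [IsSimpleGroup G] (hc : Subgroup.center G = ⊥)
    (h : FullyRealizes R G) : Function.Surjective (MulAut.conj : G →* MulAut G) := by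
  have : Finite Rˣ := let ⟨e, _⟩ := h; .of_equiv G e.symm
  have : Nontrivial Rˣ := let ⟨e, _⟩ := h; e.toEquiv.nontrivial
  have : Nontrivial R := Units.val_injective.nontrivial
  have := h.charP_two
  have := finite_unitSubring (R := R) 2
  obtain ⟨e, he⟩ := h.unitSubring
  have : IsSimpleGroup (_root_.unitSubring R)ˣ := e.isSimpleGroup
  have hc' := center_eq_bot_of_mulEquiv e.symm hc
  have := isSemisimpleRing_of_isSimpleGroup_units hc' 2
  intro σ
  obtain ⟨φ, hφ⟩ := he σ.toMonoidHom
  have hφsurj : Function.Surjective (Units.map (φ : _root_.unitSubring R →* _)) := fun u ↦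
    ⟨e.symm (σ.symm (e u)), e.injective (by simp [hφ])⟩
  obtain ⟨y, hy⟩ := exists_units_conj_of_surjective_unitsMap hc' (unitSubring_unitSubring R) hφsurj
  refine ⟨e y, MulEquiv.ext fun g ↦ ?_⟩
  simpa [hy] using hφ (e.symm g)

end FullyRealizes

theorem FullyRealizable.mulAut_conj_surjective {G : Type u} [Group G] [Finite G]
    [IsSimpleGroup G] (hc : Subgroup.center G = ⊥) (h : FullyRealizable.{u, v} G) :
    Function.Surjective (MulAut.conj : G →* MulAut G) :=
  let ⟨_, _, hR⟩ := h
  hR.mulAut_conj_surjective hc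

theorem disjoint_ker_conjNormal {G : Type*} [Group G] {N : Subgroup G} [N.Normal]
    (hN : Subgroup.center N = ⊥) :
    Disjoint N (MulAut.conjNormal : G →* MulAut N).ker := by
  refine Subgroup.disjoint_def.2 fun {x} hx hker ↦ ?_
  have hcenter : (⟨x, hx⟩ : N) ∈ Subgroup.center N := Subgroup.mem_center_iff.2 fun y ↦
    Subtype.ext (mul_inv_eq_iff_eq_mul.1 congr(($(MonoidHom.mem_ker.1 hker) y : G))).symm
  simpa [hN] using hcenter

section AlternatingGroups

variable {α : Type*} [Fintype α] [DecidableEq α]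

theorem conjNormal_alternatingGroup_injective (hα : 5 ≤ Nat.card α) :
    Function.Injective (MulAut.conjNormal : Equiv.Perm α →* MulAut (alternatingGroup α)) := by
  rw [← MonoidHom.ker_eq_bot_iff]
  by_contra hker
  have hle := Equiv.Perm.alternatingGroup_le_of_normal hα
    ((Subgroup.nontrivial_iff_ne_bot _).2 hker)
  have hdisj := disjoint_ker_conjNormal (alternatingGroup.center_eq_bot (α := α) (by omega))
  have := alternatingGroup.isSimpleGroup hα
  exact (Subgroup.nontrivial_iff_ne_bot _).1 inferInstance (hdisj.eq_bot_of_le hle)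

theorem mulAut_conj_alternatingGroup_not_surjective (hα : 5 ≤ Nat.card α) :
    ¬ Function.Surjective (MulAut.conj : alternatingGroup α →* MulAut (alternatingGroup α)) := by
  intro hsurj
  have : Nontrivial α := Finite.one_lt_card_iff_nontrivial.1 (by omega)
  obtain ⟨a, b, hab⟩ := exists_pair_ne α
  obtain ⟨y, hy⟩ := hsurj (MulAut.conjNormal (Equiv.swap a b))
  rw [← MulAut.conjNormal_val] at hy
  have hys := conjNormal_alternatingGroup_injective hα hy
  have hsign := Equiv.Perm.mem_alternatingGroup.1 (hys ▸ y.2)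
  rw [Equiv.Perm.sign_swap hab] at hsign
  exact absurd hsign (by decide)

theorem not_fullyRealizable_alternatingGroup (hα : 5 ≤ Nat.card α) :
    ¬ FullyRealizable (alternatingGroup α) := fun h ↦
  have := alternatingGroup.isSimpleGroup hα
  mulAut_conj_alternatingGroup_not_surjective hα
    (h.mulAut_conj_surjective (alternatingGroup.center_eq_bot (by omega)))

theorem not_isSimpleGroup_alternatingGroup_of_card_eq_four (hα : Nat.card α = 4) :
    ¬ IsSimpleGroup (alternatingGroup α) := by
  intro _
  have hK := alternatingGroup.kleinFour_card_of_card_eq_four hα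
  have hA := alternatingGroup.card_of_card_eq_four hα
  obtain h | h := (alternatingGroup.normal_kleinFour hα).eq_bot_or_eq_top
  · rw [h, Subgroup.card_bot] at hK
    omega
  · rw [h, Subgroup.card_top] at hK
    omega

end AlternatingGroups

namespace FullyRealizes

variable {R : Type*} [Ring R] {G : Type*} [Group G]

theorem of_mulEquiv {H : Type*} [Group H] (g : G ≃* H) (h : FullyRealizes R G) :
    FullyRealizes R H := by
  obtain ⟨e, he⟩ := h
  refine ⟨e.trans g, fun f ↦ ?_⟩
  obtain ⟨φ, hφ⟩ := he ((g.symm.toMonoidHom.comp f).comp g.toMonoidHom)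
  exact ⟨φ, fun x ↦ by simp [hφ]⟩

theorem of_ringEquiv {S : Type*} [Ring S] (r : S ≃+* R) (h : FullyRealizes R G) :
    FullyRealizes S G := by
  obtain ⟨e, he⟩ := h
  refine ⟨(Units.mapEquiv r.toMulEquiv).trans e, fun f ↦ ?_⟩
  obtain ⟨φ, hφ⟩ := he f
  refine ⟨((r.symm : R →+* S).comp φ).comp (r : S →+* R), fun x ↦ ?_⟩
  refine Eq.trans ?_ (hφ (Units.mapEquiv r.toMulEquiv x))
  exact congr_arg e (Units.ext (r.apply_symm_apply _))

theorem fullyRealizable {R : Type u} [Ring R] (h : FullyRealizes R G) :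
    FullyRealizable.{_, max u v} G :=
  ⟨ULift.{v} R, inferInstance, h.of_ringEquiv ULift.ringEquiv⟩

theorem of_subsingleton [Subsingleton Rˣ] [Subsingleton G] : FullyRealizes R G :=
  let _ : Unique G := uniqueOfSubsingleton 1
  let _ : Unique Rˣ := uniqueOfSubsingleton 1
  ⟨MulEquiv.ofUnique, fun _ ↦ ⟨RingHom.id R, fun _ ↦ Subsingleton.elim _ _⟩⟩

theorem units_of_closure_eq_top {T : Set Rˣ} (hT : Subgroup.closure T = ⊤)
    (h : ∀ f : Rˣ →* Rˣ, ∃ φ : R →+* R, ∀ t ∈ T, φ t = f t) : FullyRealizes R Rˣ := by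
  refine ⟨MulEquiv.refl _, fun f ↦ ?_⟩
  obtain ⟨φ, hφ⟩ := h f
  have heq : Units.map (φ : R →* R) = f :=
    MonoidHom.eq_of_eqOn_dense hT fun t ht ↦ Units.ext (hφ t ht)
  exact ⟨φ, DFunLike.congr_fun heq⟩

end FullyRealizes

/-- The field with four elements, as the quadratic algebra generated by `ω` with `ω² = 1 + ω`; this
presentation keeps its elements computable. -/
abbrev FieldFour : Type := QuadraticAlgebra (ZMod 2) 1 1

namespace FieldFour

instance : Fact (∀ r : ZMod 2, r ^ 2 ≠ 1 + 1 * r) := ⟨by decide⟩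

instance : Fintype FieldFour := Fintype.ofEquiv _ (QuadraticAlgebra.equivProd 1 1).symm

theorem natCard : Nat.card FieldFour = 4 := Nat.card_eq_fintype_card

theorem natCard_units : Nat.card FieldFourˣ = 3 := by
  rw [Nat.card_units, natCard]

/-- The generator `ω` of the multiplicative group, with inverse `ω² = 1 + ω`. -/
def unitGen : FieldFourˣ := ⟨⟨0, 1⟩, ⟨1, 1⟩, by decide, by decide⟩

theorem unitGen_ne_one : unitGen ≠ 1 := by decide

theorem zpowers_unitGen : Subgroup.zpowers unitGen = ⊤ :=
  have := Fact.mk Nat.prime_three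
  zpowers_eq_top_of_prime_card natCard_units unitGen_ne_one

theorem eq_one_or_exists_algHom_unitGen_eq {x : FieldFour} (hx : x ^ 3 = 1) :
    x = 1 ∨ ∃ χ : FieldFour →ₐ[ZMod 2] FieldFour, χ unitGen = x := by
  have hcases : x = 1 ∨ x = unitGen ∨ x = (unitGen : FieldFour) ^ 2 := by
    revert x
    decide
  obtain h | rfl | rfl := hcases
  · exact .inl h
  · exact .inr ⟨AlgHom.id _ _, rfl⟩
  · exact .inr ⟨FiniteField.frobeniusAlgHom (ZMod 2) FieldFour, rfl⟩

theorem natCard_units_prod_zmod_two : Nat.card (FieldFour × ZMod 2)ˣ = 3 := by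
  rw [Nat.card_congr MulEquiv.prodUnits.toEquiv, Nat.card_prod, natCard_units, Nat.card_unique]

theorem fullyRealizes_prod_zmod_two :
    FullyRealizes (FieldFour × ZMod 2) (FieldFour × ZMod 2)ˣ := by
  let g : (FieldFour × ZMod 2)ˣ := MulEquiv.prodUnits.symm (unitGen, 1)
  have hg : g ≠ 1 := fun h ↦ unitGen_ne_one <|
    congr_arg (Units.map (MonoidHom.fst FieldFour (ZMod 2))) h
  have := Fact.mk Nat.prime_three
  have hgen : Subgroup.closure {g} = ⊤ := by
    rw [← Subgroup.zpowers_eq_closure]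
    exact zpowers_eq_top_of_prime_card natCard_units_prod_zmod_two hg
  refine .units_of_closure_eq_top hgen fun f ↦ ?_
  obtain ⟨⟨x, c⟩, hy⟩ := MulEquiv.prodUnits.symm.surjective (f g)
  obtain rfl := Subsingleton.elim c 1
  have hx3 : (x : FieldFour) ^ 3 = 1 := by
    rw [← Units.val_pow_eq_pow_val, ← natCard_units, pow_card_eq_one', Units.val_one]
  simp only [Set.mem_singleton_iff, forall_eq, ← hy]
  obtain hx | ⟨χ, hχ⟩ := eq_one_or_exists_algHom_unitGen_eq hx3
  · exact ⟨((algebraMap (ZMod 2) FieldFour).prod (RingHom.id _)).comp (RingHom.snd _ _),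
      Prod.ext hx.symm rfl⟩
  · exact ⟨(χ : FieldFour →+* FieldFour).prodMap (RingHom.id _), Prod.ext hχ rfl⟩

end FieldFour

theorem fullyRealizable_alternatingGroup_two :
    FullyRealizable.{0, v} (alternatingGroup (Fin 2)) :=
  have : Subsingleton (alternatingGroup (Fin 2)) := by
    rw [alternatingGroup.eq_bot_of_card_le_two (by simp)]
    infer_instance
  (FullyRealizes.of_subsingleton (R := ZMod 2)).fullyRealizable

theorem fullyRealizable_alternatingGroup_three :
    FullyRealizable.{0, v} (alternatingGroup (Fin 3)) := by
  have := Fact.mk Nat.prime_three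
  have hcard : Nat.card (alternatingGroup (Fin 3)) = 3 := by
    rw [nat_card_alternatingGroup, Nat.card_fin]
    rfl
  exact (FieldFour.fullyRealizes_prod_zmod_two.of_mulEquiv
    (mulEquivOfPrimeCardEq FieldFour.natCard_units_prod_zmod_two hcard)).fullyRealizable

/-- The ring of triangular matrices `!![a, b; 0, c]` with `a b : A` and `c : k`. -/
@[ext]
structure TriangularRing (k A : Type*) where
  a : A
  b : A
  c : k

namespace TriangularRing

section Ring

variable {k A : Type*} [CommRing k] [CommRing A]

instance : Zero (TriangularRing k A) := ⟨⟨0, 0, 0⟩⟩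
instance : One (TriangularRing k A) := ⟨⟨1, 0, 1⟩⟩
instance : Add (TriangularRing k A) := ⟨fun x y ↦ ⟨x.a + y.a, x.b + y.b, x.c + y.c⟩⟩
instance : Neg (TriangularRing k A) := ⟨fun x ↦ ⟨-x.a, -x.b, -x.c⟩⟩

@[simp] theorem zero_a : (0 : TriangularRing k A).a = 0 := rfl
@[simp] theorem zero_b : (0 : TriangularRing k A).b = 0 := rfl
@[simp] theorem zero_c : (0 : TriangularRing k A).c = 0 := rfl
@[simp] theorem one_a : (1 : TriangularRing k A).a = 1 := rfl
@[simp] theorem one_b : (1 : TriangularRing k A).b = 0 := rfl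
@[simp] theorem one_c : (1 : TriangularRing k A).c = 1 := rfl
@[simp] theorem add_a (x y : TriangularRing k A) : (x + y).a = x.a + y.a := rfl
@[simp] theorem add_b (x y : TriangularRing k A) : (x + y).b = x.b + y.b := rfl
@[simp] theorem add_c (x y : TriangularRing k A) : (x + y).c = x.c + y.c := rfl
@[simp] theorem neg_a (x : TriangularRing k A) : (-x).a = -x.a := rfl
@[simp] theorem neg_b (x : TriangularRing k A) : (-x).b = -x.b := rfl
@[simp] theorem neg_c (x : TriangularRing k A) : (-x).c = -x.c := rfl

variable [Algebra k A]

instance : Mul (TriangularRing k A) :=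
  ⟨fun x y ↦ ⟨x.a * y.a, x.a * y.b + x.b * algebraMap k A y.c, x.c * y.c⟩⟩

@[simp] theorem mul_a (x y : TriangularRing k A) : (x * y).a = x.a * y.a := rfl
@[simp] theorem mul_b (x y : TriangularRing k A) :
    (x * y).b = x.a * y.b + x.b * algebraMap k A y.c := rfl
@[simp] theorem mul_c (x y : TriangularRing k A) : (x * y).c = x.c * y.c := rfl

instance : Ring (TriangularRing k A) where
  add_assoc x y z := by ext <;> simp [add_assoc]
  zero_add x := by ext <;> simp
  add_zero x := by ext <;> simp
  add_comm x y := by ext <;> simp [add_comm]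
  neg_add_cancel x := by ext <;> simp
  mul_assoc x y z := by ext <;> simp <;> ring
  one_mul x := by ext <;> simp
  mul_one x := by ext <;> simp
  zero_mul x := by ext <;> simp
  mul_zero x := by ext <;> simp
  left_distrib x y z := by ext <;> simp <;> ring
  right_distrib x y z := by ext <;> simp <;> ring
  nsmul := nsmulRec
  zsmul := zsmulRec

/-- The endomorphism acting by `χ` on the upper left entry, by `d • χ` on the upper right entry, and
conjugated by the unipotent matrix with upper right entry `-b`. -/
def twist (χ : A →ₐ[k] A) (d b : A) : TriangularRing k A →+* TriangularRing k A where
  toFun x := ⟨χ x.a, d * χ x.b + b * (χ x.a - algebraMap k A x.c), x.c⟩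
  map_zero' := by ext <;> simp
  map_one' := by ext <;> simp
  map_add' x y := by ext <;> simp; ring
  map_mul' x y := by ext <;> simp; ring

/-- The endomorphism which replaces both diagonal entries by the lower right one and kills the upper
right entry. -/
def collapse : TriangularRing k A →+* TriangularRing k A where
  toFun x := ⟨algebraMap k A x.c, 0, x.c⟩
  map_zero' := by ext <;> simp
  map_one' := by ext <;> simp
  map_add' x y := by ext <;> simp
  map_mul' x y := by ext <;> simp

/-- The unit `!![a, b; 0, 1]`. -/
def unit (a : Aˣ) (b : A) : (TriangularRing k A)ˣ where
  val := ⟨a, b, 1⟩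
  inv := ⟨(a⁻¹ : Aˣ), -((a⁻¹ : Aˣ) * b), 1⟩
  val_inv := by ext <;> simp
  inv_val := by ext <;> simp

theorem coe_unit (a : Aˣ) (b : A) :
    ((unit a b : (TriangularRing k A)ˣ) : TriangularRing k A) = ⟨a, b, 1⟩ := rfl

theorem unit_one_zero : (unit 1 0 : (TriangularRing k A)ˣ) = 1 := Units.ext rfl

theorem unit_mul_unit (a a' : Aˣ) (b b' : A) :
    (unit a b * unit a' b' : (TriangularRing k A)ˣ) = unit (a * a') (a * b' + b) := by
  ext <;> simp [coe_unit]

theorem unit_injective :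
    Function.Injective fun p : Aˣ × A ↦ (unit p.1 p.2 : (TriangularRing k A)ˣ) := by
  intro p q h
  have h' := congr_arg Units.val h
  exact Prod.ext (Units.ext (congr_arg TriangularRing.a h')) (congr_arg TriangularRing.b h')

end Ring

section Units

variable {k A : Type*} [CommRing k] [Subsingleton kˣ] [CommRing A] [Algebra k A]

theorem exists_eq_unit (u : (TriangularRing k A)ˣ) : ∃ a b, u = unit a b := by
  let a : Aˣ := ⟨(u : TriangularRing k A).a, (u⁻¹ : (TriangularRing k A)ˣ).val.a,
    congr_arg TriangularRing.a u.mul_inv, congr_arg TriangularRing.a u.inv_mul⟩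
  let c : kˣ := ⟨(u : TriangularRing k A).c, (u⁻¹ : (TriangularRing k A)ˣ).val.c,
    congr_arg TriangularRing.c u.mul_inv, congr_arg TriangularRing.c u.inv_mul⟩
  have hc : (u : TriangularRing k A).c = 1 := congr_arg Units.val (Subsingleton.elim c 1)
  exact ⟨a, (u : TriangularRing k A).b, Units.ext (TriangularRing.ext rfl rfl hc)⟩

theorem natCard_units : Nat.card (TriangularRing k A)ˣ = Nat.card Aˣ * Nat.card A := by
  rw [← Nat.card_prod]
  refine (Nat.card_eq_of_bijective _ ⟨unit_injective, fun u ↦ ?_⟩).symm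
  obtain ⟨a, b, rfl⟩ := exists_eq_unit u
  exact ⟨(a, b), rfl⟩

variable (k A) in
/-- The action of the units, whose lower right entry is `1`, on the affine line `A` by
`x ↦ a * x + b`. -/
def affineAction :
    (TriangularRing k A)ˣ →* Equiv.Perm A :=
  MonoidHom.toHomPerm
    { toFun := fun u x ↦ (u : TriangularRing k A).a * x + (u : TriangularRing k A).b
      map_one' := funext fun x ↦ show 1 * x + 0 = x by rw [one_mul, add_zero]
      map_mul' := fun u w ↦ by
        obtain ⟨a, b, rfl⟩ := exists_eq_unit u
        obtain ⟨a', b', rfl⟩ := exists_eq_unit w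
        funext x
        change (a * a' : A) * x + (a * b' + b * algebraMap k A 1) = a * (a' * x + b') + b
        rw [map_one]
        ring }

theorem affineAction_unit (a : Aˣ) (b x : A) : affineAction k A (unit a b) x = a * x + b := rfl

theorem affineAction_injective : Function.Injective (affineAction k A) := by
  rw [injective_iff_map_eq_one]
  intro u hu
  obtain ⟨a, b, rfl⟩ := exists_eq_unit u
  have hb : b = 0 := by simpa [affineAction_unit] using congr($hu 0)
  subst hb
  have ha : a = 1 := by simpa [affineAction_unit] using congr($hu 1)
  rw [ha, unit_one_zero]

theorem closure_pair_eq_top {K : Type*} [Field K] [Algebra k K] {ω : Kˣ}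
    (hω : Subgroup.zpowers ω = ⊤) :
    Subgroup.closure {unit ω 0, (unit 1 1 : (TriangularRing k K)ˣ)} = ⊤ := by
  let diagonal : Kˣ →* (TriangularRing k K)ˣ := .mk' (unit · 0) fun a a' ↦ by simp [unit_mul_unit]
  have hdiag (a : Kˣ) : diagonal a ∈ Subgroup.closure {unit ω 0, unit 1 1} := by
    obtain ⟨n, rfl⟩ := Subgroup.mem_zpowers_iff.1 (hω ▸ Subgroup.mem_top a)
    rw [map_zpow]
    exact Subgroup.zpow_mem _ (Subgroup.subset_closure (.inl rfl)) n
  refine (Subgroup.eq_top_iff' _).2 fun u ↦ ?_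
  obtain ⟨a, b, rfl⟩ := exists_eq_unit u
  obtain rfl | hb := eq_or_ne b 0
  · exact hdiag a
  · obtain ⟨b, rfl⟩ := hb.isUnit
    have hab : unit a b = diagonal b * unit 1 1 * diagonal (b⁻¹ * a) := by
      simp [diagonal, unit_mul_unit]
    rw [hab]
    exact mul_mem (mul_mem (hdiag b) (Subgroup.subset_closure (.inr rfl))) (hdiag _)

end Units

section Four

open FieldFour

/-- The ring of triangular matrices realizing the alternating group on four letters. -/
abbrev Four : Type := TriangularRing (ZMod 2) FieldFour

theorem unit_one_pow_three (b : FieldFour) : (unit 1 b : Fourˣ) ^ 3 = unit 1 b := by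
  have hb : b + b = 0 := (by decide : ∀ b : FieldFour, b + b = 0) b
  simp [pow_succ, unit_mul_unit, hb]

theorem exists_twist_eq_of_pow_three_eq_one {u : Fourˣ} (hu : u ^ 3 = 1) (hne : u ≠ 1) :
    ∃ (χ : FieldFour →ₐ[ZMod 2] FieldFour) (c : FieldFour), ∀ d,
      twist χ d c (unit unitGen 0 : Fourˣ) = u := by
  obtain ⟨a, b, rfl⟩ := exists_eq_unit u
  have ha : a ≠ 1 := by
    rintro rfl
    exact hne ((unit_one_pow_three b).symm.trans hu)
  have ha3 : (a : FieldFour) ^ 3 = 1 := congr_arg (fun u : Fourˣ ↦ (u : Four).a) hu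
  have hval : (a : FieldFour) ≠ 1 := Units.val_eq_one.not.2 ha
  have hsub : (a : FieldFour) - 1 ≠ 0 := sub_ne_zero.2 hval
  obtain ⟨χ, hχ⟩ := (eq_one_or_exists_algHom_unitGen_eq ha3).resolve_left hval
  refine ⟨χ, b / (a - 1), fun d ↦ ?_⟩
  ext1 <;> simp [twist, coe_unit, hχ, hsub]

theorem exists_eq_unit_one_of_sq_eq_one {u : Fourˣ} (hu : u ^ 2 = 1) : ∃ d, u = unit 1 d := by
  obtain ⟨a, d, rfl⟩ := exists_eq_unit u
  have ha : (a : FieldFour) ^ 2 = 1 := congr_arg (fun u : Fourˣ ↦ (u : Four).a) hu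
  have ha1 := (by decide : ∀ a : FieldFour, a ^ 2 = 1 → a = 1) a ha
  exact ⟨d, by rw [Units.val_eq_one.1 ha1]⟩

theorem fullyRealizes_units_four : FullyRealizes Four Fourˣ := by
  refine .units_of_closure_eq_top (closure_pair_eq_top zpowers_unitGen) fun f ↦ ?_
  have hs : f (unit unitGen 0) ^ 3 = 1 := by
    rw [← map_pow, show (unit unitGen 0 : Fourˣ) ^ 3 = 1 from Units.ext rfl, map_one]
  have ht : f (unit 1 1) ^ 2 = 1 := by
    rw [← map_pow, show (unit 1 1 : Fourˣ) ^ 2 = 1 from Units.ext rfl, map_one]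
  have hst : (f (unit unitGen 0) * f (unit 1 1)) ^ 3 = 1 := by
    rw [← map_mul, ← map_pow, show (unit unitGen 0 * unit 1 1 : Fourˣ) ^ 3 = 1 from Units.ext rfl,
      map_one]
  obtain ⟨d, hd⟩ := exists_eq_unit_one_of_sq_eq_one ht
  simp only [Set.forall_mem_insert, Set.mem_singleton_iff, forall_eq]
  by_cases h1 : f (unit unitGen 0) = 1
  · rw [h1, one_mul, hd, unit_one_pow_three] at hst
    exact ⟨collapse, by rw [h1]; rfl, by rw [hd, hst]; rfl⟩
  · obtain ⟨χ, c, h⟩ := exists_twist_eq_of_pow_three_eq_one hs h1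
    exact ⟨twist χ d c, h d, by rw [hd]; ext1 <;> simp [twist, coe_unit]⟩

theorem range_affineAction_four :
    (affineAction (ZMod 2) FieldFour).range = alternatingGroup FieldFour := by
  apply Equiv.Perm.eq_alternatingGroup_of_index_eq_two
  have hcard : Nat.card (affineAction (ZMod 2) FieldFour).range = 12 := by
    rw [← Nat.card_congr (MonoidHom.ofInjective affineAction_injective).toEquiv, natCard_units,
      FieldFour.natCard_units, natCard]
  have h24 : Nat.card (Equiv.Perm FieldFour) = 24 := by
    rw [Nat.card_perm, natCard]
    rfl
  have hindex := (affineAction (ZMod 2) FieldFour).range.index_mul_card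
  rw [hcard, h24] at hindex
  omega

/-- The units of `Four` form the affine group of the line over the field with four elements, all of
whose elements are even permutations. -/
noncomputable def unitsFourEquivAlternatingGroup : Fourˣ ≃* alternatingGroup FieldFour :=
  (MonoidHom.ofInjective affineAction_injective).trans
    (MulEquiv.subgroupCongr range_affineAction_four)

end Four

end TriangularRing

theorem fullyRealizable_alternatingGroup_four :
    FullyRealizable.{0, v} (alternatingGroup (Fin 4)) :=
  (TriangularRing.fullyRealizes_units_four.of_mulEquiv
    (TriangularRing.unitsFourEquivAlternatingGroup.trans
      (Equiv.altCongrHom (Fintype.equivFinOfCardEq rfl)))).fullyRealizable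

theorem mainTheorem4 :
    FullyRealizable.{0, v} (alternatingGroup (Fin 2)) ∧
    FullyRealizable.{0, v} (alternatingGroup (Fin 3)) ∧
    ∀ n : ℕ, 4 ≤ n →
      List.TFAE
        [n = 4,
         FullyRealizable.{0, v} (alternatingGroup (Fin n)),
         ¬ IsSimpleGroup (alternatingGroup (Fin n))] := by
  refine ⟨fullyRealizable_alternatingGroup_two, fullyRealizable_alternatingGroup_three,
    fun n hn ↦ ?_⟩
  have hcard : Nat.card (Fin n) = n := Nat.card_fin n
  tfae_have 1 → 2 := by
    rintro rfl
    exact fullyRealizable_alternatingGroup_four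
  tfae_have 2 → 1 := fun h ↦ by
    by_contra h4
    exact not_fullyRealizable_alternatingGroup (by omega) h
  tfae_have 1 → 3 := by
    rintro rfl
    exact not_isSimpleGroup_alternatingGroup_of_card_eq_four hcard
  tfae_have 3 → 1 := fun h ↦ by
    by_contra h4
    exact h (alternatingGroup.isSimpleGroup (by omega))
  tfae_finish
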